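/- **Problem.** Let $f:\mathbb R^n\to\mathbb R$ be convex and differentiable with $\|\nabla f(u)-\nabla f(v)\|\le L_f\|u-v\|$ on $\mathbb R^n$, $L_f>0$; let $U\subset\mathbb R^n$ be nonempty, closed, convex and bounded with diameter $D_U$; let $G\in\mathbb R^{m\times n}$ (spectral norm $\|G\|$) and $g\in\mathbb R^m$. Let $f^*$ be the optimal value of $\min\{f(u): u\in U,\ Gu+g=0\}$, and suppose that an optimal solution exists. For $\rho,\mu\ge 0$ put $$\mathcal L_{\mu\rho}(u,x)=f(u)+\langle x,Gu+g\rangle+\tfrac{\rho}{2}\|Gu+g\|^2-\tfrac{\mu}{2}\|x\|^2,\quad d_\rho(x)=\min_{u\in U}\mathcal L_{0\rho}(u,x),\quad f_\mu(u)=\max_{x\in\mathbb R^m}\mathcal L_{\mu0}(u,x)\ (\mu>0).$$ Let $x^*$ be an optimal Lagrange multiplier, i.e. $d_0(x^*)=f^*$, with $\|x^*\|\ge 2$. A point $u\in U$ is $\epsilon$-optimal if $f(u)-f^*\le\epsilon$ and $\|Gu+g\|\le\epsilon$. **Algorithm A-IFAL$(\rho_0,\epsilon)$.** Let $\rho_0,\epsilon>0$,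 and let $u^0\in U$, $x^0\in\mathbb R^m$ satisfy $f_{4/\rho_0}(u^0)-d_{\rho_0}(x^0)\le\epsilon/6$. For $k=1,2,\dots$, with $\rho=2^{k-1}\rho_0$, $\mu=4/\rho$ and $\tau=2/3$ (a single, first, iteration of IFAL$(\rho,\epsilon)$): 1. $\hat x=(1-\tau)x^{k-1}+\frac{\tau}{\mu}(Gu^{k-1}+g)$; 2. starting from any point of $U$, apply Nesterov's optimal method (accelerated projected gradient with step $1/L$, $L=L_f+\rho\|G\|^2$, initial parameter $\alpha_0=1$, one projection onto $U$ per iteration) to $\min_{u\in U}\mathcal L_{0\rho}(u,\hat x)$, and let $\tilde u$ be its final iterate. The method is stopped either at the first iterate $\tilde u$ with $\mathcal L_{0\rho}(\tilde u,\hat x)-d_\rho(\hat x)\le\epsilon/6$, or after the number $\max\{1,\lfloor 2D_U\sqrt{6L/\epsilon}\rfloor\}$ of iterations, fixed in advance; 3. $u^k=(1-\tau)u^{k-1}+\tau\tilde u$ and $x^k=\hat x+\rho(G\tilde u+g)$; stop if $\|Gu^k+g\|\le\epsilon$. **Theorem.** Every run of A-IFAL$(\rho_0,\epsilon)$ stops,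 at some iteration $K\le\max\{1,\log_2\frac{16\|x^*\|^2}{\epsilon\rho_0}\}$; in each performed iteration $\tilde u\in U$ and $\mathcal L_{0\rho}(\tilde u,\hat x)-d_\rho(\hat x)\le\epsilon/6$; and $u^K$ is an $\epsilon$-optimal solution. Let $N$ be the total number of projections onto $U$ in these $K$ iterations. * If $\rho_0\le 16\|x^*\|^2/\epsilon$, then $$N\le\max\Big\{1,\log_2\frac{16\|x^*\|^2}{\epsilon\rho_0}\Big\}\max\Big\{1,\sqrt{\frac{24L_fD_U^2}{\epsilon}}\Big\}+\frac{80\sqrt3\,D_U\|G\|\|x^*\|}{\epsilon}.$$ * If $1\le\rho_0\le 16\|x^*\|^2/\epsilon$, $\ \epsilon\le 8\|x^*\|^2$ and $\epsilon\le 24(L_f+\rho_0\|G\|^2)D_U^2$, then $$N\le\log_2\Big(\frac{16\|x^*\|^2}{\epsilon}\Big)\sqrt{\frac{24L_fD_U^2}{\epsilon}}+\frac{80\sqrt3\,D_U\|G\|\|x^*\|}{\epsilon}.$$ -/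

import Mathlib

open scoped InnerProductSpace

namespace IFAL

noncomputable section

/-- Euclidean space of dimension `d`. -/
abbrev E (d : ℕ) := EuclideanSpace ℝ (Fin d)

/-- Data of the problem: minimize `f u` over `u ∈ U` subject to `G u + g = 0`.
The matrix `G` is given as a linear map between Euclidean spaces, so that `‖G‖` is its
spectral norm. -/
structure Problem (n m : ℕ) where
  f : E n → ℝ
  U : Set (E n)
  G : E n →L[ℝ] E m
  g : E m

namespace Problem

variable {n m : ℕ} (P : Problem n m)

/-- The residual `G u + g` of the linear constraint. -/
def residual (u : E n) : E m := P.G u + P.g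

/-- The feasible points: `u ∈ U` with `G u + g = 0`. -/
def feasibleSet : Set (E n) := {u | u ∈ P.U ∧ P.residual u = 0}

/-- The set of optimal solutions. -/
def optimalSet : Set (E n) := {u | u ∈ P.feasibleSet ∧ ∀ v ∈ P.feasibleSet, P.f u ≤ P.f v}

/-- The optimal value `f*`. -/
def optValue : ℝ := sInf (P.f '' P.feasibleSet)

/-- The doubly smoothed Lagrangian
`f u + ⟨x, G u + g⟩ + (ρ / 2) ‖G u + g‖² - (μ / 2) ‖x‖²`. -/
def lagrangian (μ ρ : ℝ) (u : E n) (x : E m) : ℝ :=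
  P.f u + ⟪x, P.residual u⟫_ℝ + ρ / 2 * ‖P.residual u‖ ^ 2 - μ / 2 * ‖x‖ ^ 2

/-- The smoothed dual function `min_{u ∈ U} L_{0ρ}(u, x)`; for `ρ = 0` it is the Lagrangian dual
function. -/
def smoothDual (ρ : ℝ) (x : E m) : ℝ := sInf ((fun u => P.lagrangian 0 ρ u x) '' P.U)

/-- The smoothed primal function `max_x L_{μ0}(u, x)`. -/
def smoothPrimal (μ : ℝ) (u : E n) : ℝ := ⨆ x : E m, P.lagrangian μ 0 u x

/-- `x` is an optimal Lagrange multiplier: the dual function attains the value `f*` at `x`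
(by weak duality `x` is then a maximizer of the dual function). -/
def IsOptimalMultiplier (x : E m) : Prop := P.smoothDual 0 x = P.optValue

/-- The blanket assumptions: `f` is convex and differentiable with `Lf`-Lipschitz gradient on the
whole space, `Lf > 0`, the set `U` is nonempty, convex, closed and bounded, and an optimal solution
exists. -/
structure Assumptions (Lf : ℝ) : Prop where
  Lf_pos : 0 < Lf
  convex_f : ConvexOn ℝ Set.univ P.f
  differentiable_f : Differentiable ℝ P.f
  lipschitz_gradient : ∀ u v : E n, ‖gradient P.f u - gradient P.f v‖ ≤ Lf * ‖u - v‖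
  nonempty_U : P.U.Nonempty
  convex_U : Convex ℝ P.U
  closed_U : IsClosed P.U
  bounded_U : Bornology.IsBounded P.U
  exists_optimal : P.optimalSet.Nonempty

/-- `ε`-optimal solutions. -/
def IsEpsOptimal (ε : ℝ) (u : E n) : Prop :=
  u ∈ P.U ∧ P.f u - P.optValue ≤ ε ∧ ‖P.residual u‖ ≤ ε

/-- The Lipschitz constant `Lf + ρ ‖G‖²` of the gradient of `L_{0ρ}(·, x)`. -/
def lipLagrangian (Lf ρ : ℝ) : ℝ := Lf + ρ * ‖P.G‖ ^ 2

end Problem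

/-! ### The inner solver: Nesterov's optimal method with one projection per iteration -/

/-- The Euclidean projection of `z` onto `U` (the unique nearest point, when `U` is nonempty, closed
and convex). -/
def proj {n : ℕ} (U : Set (E n)) (z : E n) : E n :=
  Classical.epsilon fun p => p ∈ U ∧ ∀ w ∈ U, dist z p ≤ dist z w

/-- State of Nesterov's method: current iterate, extrapolated point, extrapolation parameter, and
the number of projections onto `U` performed so far. -/
structure NesterovState (n : ℕ) where
  point : E n
  extra : E n
  t : ℝ
  projections : ℕ

/-- Nesterov's optimal (accelerated projected gradient) method with constant step `1 / L` for
minimizing `φ` over `U`, started at `v`. With `α = 1 / t` the parameters obey Nesterov's recursion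
`α₊² = (1 - α₊) α²`, with initial value `α = 1`, and `(t - 1) / t₊ = α (1 - α) / (α² + α₊)`. -/
def nesterov {n : ℕ} (φ : E n → ℝ) (U : Set (E n)) (L : ℝ) (v : E n) : ℕ → NesterovState n
  | 0 => ⟨v, v, 1, 0⟩
  | j + 1 =>
    let s := nesterov φ U L v j
    let w := proj U (s.extra - (1 / L) • gradient φ s.extra)
    let t' := (1 + Real.sqrt (1 + 4 * s.t ^ 2)) / 2
    ⟨w, w + ((s.t - 1) / t') • (w - s.point), t', s.projections + 1⟩

/-! ### One iteration of IFAL and the adaptive algorithm -/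

/-- The step parameter `τ_k = 2 / (k + 3)` of IFAL. -/
def tau (k : ℕ) : ℝ := 2 / ((k : ℝ) + 3)

/-- The inner accuracy `δ_k = ε / (2 (k + 3))` of IFAL. -/
def delta (ε : ℝ) (k : ℕ) : ℝ := ε / (2 * ((k : ℝ) + 3))

namespace Problem

variable {n m : ℕ} (P : Problem n m)

/-- The dual point `(1 - τ) x + (τ / μ) (G u + g)` at which IFAL calls the inner solver. -/
def hatX (μ τ : ℝ) (u : E n) (x : E m) : E m := (1 - τ) • x + (τ / μ) • P.residual u

/-- The state after `j` iterations of Nesterov's method, started at `v`, for the inner subproblem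
`min_{u ∈ U} L_{0ρ}(u, y)`. -/
def inner (Lf ρ : ℝ) (y : E m) (v : E n) (j : ℕ) : NesterovState n :=
  nesterov (fun u => P.lagrangian 0 ρ u y) P.U (P.lipLagrangian Lf ρ) v j

/-- `w` solves the inner subproblem `min_{u ∈ U} L_{0ρ}(u, y)` with accuracy `δ`. -/
def IsInnerSolution (ρ δ : ℝ) (y : E m) (w : E n) : Prop :=
  w ∈ P.U ∧ P.lagrangian 0 ρ w y - P.smoothDual ρ y ≤ δ

/-- The number of iterations of the inner solver that is fixed in advance when it is not stopped
by the observed accuracy: `2 D_U √(L / δ)` rounded down, but at least one. -/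
def innerBudget (Lf ρ δ : ℝ) : ℕ :=
  max 1 ⌊2 * Metric.diam P.U * Real.sqrt (P.lipLagrangian Lf ρ / δ)⌋₊

/-- The inner solver, called at the dual point `y` and started at `v`, is stopped after `j`
iterations: either `j` is the first index at which the accuracy `δ` is attained, or `j` is the
number fixed in advance. -/
def InnerStop (Lf ρ δ : ℝ) (y : E m) (v : E n) (j : ℕ) : Prop :=
  IsLeast {i | P.IsInnerSolution ρ δ y (P.inner Lf ρ y v i).point} j ∨
    j = P.innerBudget Lf ρ δ

/-- One IFAL iteration with parameters `ρ, μ, τ, δ` leads from `(u, x)` to `(u', x')`, where the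
inner solver is started at `v ∈ U` and performs `j` iterations. -/
def IsIFALStep (Lf ρ μ τ δ : ℝ) (u : E n) (x : E m) (v : E n) (j : ℕ)
    (u' : E n) (x' : E m) : Prop :=
  v ∈ P.U ∧
  P.InnerStop Lf ρ δ (P.hatX μ τ u x) v j ∧
  u' = (1 - τ) • u + τ • (P.inner Lf ρ (P.hatX μ τ u x) v j).point ∧
  x' = P.hatX μ τ u x + ρ • P.residual (P.inner Lf ρ (P.hatX μ τ u x) v j).point

/-- A run of A-IFAL(`ρ₀`, `ε`). The pair `(u 0, x 0)` has smoothed duality gap at most `δ_0`, for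
the parameters `ρ₀` and `μ₀ = 4 / ρ₀`. As long as none of `u 1, …, u k` has residual at most `ε`,
the pair `(u (k + 1), x (k + 1))` results from `(u k, x k)` by the first (index `0`) iteration of
IFAL with `ρ = 2 ^ k ρ₀`, that is, with `μ = 4 / ρ`, `τ = τ_0`, `δ = δ_0`. In this iteration the
inner solver starts at `start k` and makes `steps k` iterations. Values of the four sequences
after the stopping index are irrelevant. -/
structure AIFALRun (Lf ρ₀ ε : ℝ) where
  u : ℕ → E n
  x : ℕ → E m
  start : ℕ → E n
  steps : ℕ → ℕ
  u_zero_mem : u 0 ∈ P.U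
  init_gap : P.smoothPrimal (4 / ρ₀) (u 0) - P.smoothDual ρ₀ (x 0) ≤ delta ε 0
  step : ∀ k : ℕ, (∀ i, 1 ≤ i → i ≤ k → ε < ‖P.residual (u i)‖) →
    P.IsIFALStep Lf (2 ^ k * ρ₀) (4 / (2 ^ k * ρ₀)) (tau 0) (delta ε 0)
      (u k) (x k) (start k) (steps k) (u (k + 1)) (x (k + 1))

namespace AIFALRun

variable {P} {Lf ρ₀ ε : ℝ} (R : P.AIFALRun Lf ρ₀ ε)

/-- The algorithm stops at (outer) iteration `K`, the first `K ≥ 1` with `‖G u^K + g‖ ≤ ε`. -/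
def StopsAt (K : ℕ) : Prop :=
  IsLeast {k | 1 ≤ k ∧ ‖P.residual (R.u k)‖ ≤ ε} K

/-- The dual point at which the inner solver is called in iteration `k + 1`. -/
def callPoint (k : ℕ) : E m := P.hatX (4 / (2 ^ k * ρ₀)) (tau 0) (R.u k) (R.x k)

/-- The final state of the inner solver in iteration `k + 1`. -/
def innerState (k : ℕ) : NesterovState n :=
  P.inner Lf (2 ^ k * ρ₀) (R.callPoint k) (R.start k) (R.steps k)

/-- The number of projections onto `U` performed in the first `K` iterations. -/
def totalProjections (K : ℕ) : ℕ := ∑ k ∈ Finset.range K, (R.innerState k).projections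

end AIFALRun

end Problem

end

end IFAL

/-!
The proof follows the excessive gap technique. The quantity that is controlled is the smoothed
duality gap `f_μ(u) - d_ρ(x)`.

* One iteration with `τ = 2 / 3` and `μ ρ = 4` replaces a gap at most `Γ` by a gap at most
  `(1 - τ) Γ + 2 δ`, where `δ` is the inner accuracy, while `μ` is multiplied by `1 - τ = 1 / 3`
  (`smoothPrimal_sub_smoothDual_le`). For `δ = ε / 6` the bound `Γ = ε / 2` is therefore invariant,
  and it survives the passage to `2 ρ` and `μ / 2`, because `f_μ` decreases in `μ` and `d_ρ`
  increases in `ρ` (`AIFALRun.Continues.gap_le`). The inexactness of the inner solution costs only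
  `2 δ`, by strong convexity of the augmented Lagrangian in the direction of the residual
  (`IsInnerSolution.lagrangian_le_smoothDual`).
* By weak duality the gap bounds `f(u) - f*`, and by the optimality of `x*` it bounds the residual:
  `‖G u + g‖² ≤ 2 μ (Γ + ‖x*‖ ‖G u + g‖)`. Once `ρ > 4 ‖x*‖² / ε` this makes the residual at most
  `ε`. Since `ρ` doubles in each iteration, this yields the bound on the number of iterations.
* Nesterov's method satisfies `φ(u_j) - min φ ≤ 2 L D² / (j + 1)²` (`sq_mul_nesterov_sub_le`), by
  monotonicity of the energy `nesterovEnergy`. Hence the number of inner iterations that is fixed in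
  advance always reaches the accuracy `δ`, and each inner call costs at most
  `max 1 (2 D √(L / δ))` projections. By `√(a + b) ≤ √a + √b` this splits into a part that depends
  only on `Lf`, which is multiplied by the number of iterations, and a part proportional to `√ρ`,
  which sums to a geometric series dominated by its last term (`sum_penalty_cost_le`).
-/

open scoped InnerProductSpace

namespace IFAL

/-! ### Parameters of the first IFAL iteration -/

lemma delta_zero (ε : ℝ) : delta ε 0 = ε / 6 := by
  unfold delta
  norm_num

lemma tau_zero : tau 0 = 2 / 3 := by norm_num [tau]

/-! ### Smooth convex functions -/

section Smooth

variable {F : Type*} [NormedAddCommGroup F] [InnerProductSpace ℝ F] [CompleteSpace F]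

lemma hasDerivAt_comp_line {φ : F → ℝ} (hd : Differentiable ℝ φ) (x d : F) (t : ℝ) :
    HasDerivAt (fun s : ℝ => φ (x + s • d)) ⟪gradient φ (x + t • d), d⟫_ℝ t := by
  have h1 : HasDerivAt (fun s : ℝ => x + s • d) d t := by
    simpa using ((hasDerivAt_id t).smul_const d).const_add x
  simpa [Function.comp_def] using (hd (x + t • d)).hasFDerivAt.comp_hasDerivAt t h1

lemma _root_.ConvexOn.add_inner_gradient_le {φ : F → ℝ} (hc : ConvexOn ℝ Set.univ φ)
    (hd : Differentiable ℝ φ) (x z : F) : φ x + ⟪gradient φ x, z - x⟫_ℝ ≤ φ z := by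
  have hc' : ConvexOn ℝ Set.univ (fun s : ℝ => φ (x + s • (z - x))) := by
    refine ⟨convex_univ, fun a _ b _ p q hp hq hpq => ?_⟩
    have := hc.2 (Set.mem_univ (x + a • (z - x))) (Set.mem_univ (x + b • (z - x))) hp hq hpq
    refine le_trans (le_of_eq ?_) this
    have hx : x = p • x + q • x := by rw [← add_smul, hpq, one_smul]
    nth_rewrite 1 [hx]
    simp only [smul_add, smul_smul, smul_eq_mul, add_smul]
    congr 1
    abel
  have := hc'.le_slope_of_hasDerivAt (Set.mem_univ 0) (Set.mem_univ 1) one_pos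
    (hasDerivAt_comp_line hd x (z - x) 0)
  simp only [slope_def_field, zero_smul, add_zero, one_smul, add_sub_cancel, sub_zero,
    div_one] at this
  linarith

/-- The descent lemma: a function with `L`-Lipschitz gradient lies below its quadratic models. -/
lemma le_add_inner_gradient_add_sq {φ : F → ℝ} {L : ℝ} (hd : Differentiable ℝ φ)
    (hL : ∀ u v, ‖gradient φ u - gradient φ v‖ ≤ L * ‖u - v‖) (x z : F) :
    φ z ≤ φ x + ⟪gradient φ x, z - x⟫_ℝ + L / 2 * ‖z - x‖ ^ 2 := by
  set d := z - x with hdz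
  let h : ℝ → ℝ := fun s => φ (x + s • d) - s * ⟪gradient φ x, d⟫_ℝ - L / 2 * ‖d‖ ^ 2 * s ^ 2
  have hder (t : ℝ) : HasDerivAt h
      (⟪gradient φ (x + t • d), d⟫_ℝ - ⟪gradient φ x, d⟫_ℝ - L * ‖d‖ ^ 2 * t) t := by
    have := ((hasDerivAt_comp_line hd x d t).sub
      ((hasDerivAt_id t).mul_const ⟪gradient φ x, d⟫_ℝ)).sub
      ((hasDerivAt_pow 2 t).const_mul (L / 2 * ‖d‖ ^ 2))
    refine this.congr_deriv ?_
    push_cast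
    ring
  have hanti : AntitoneOn h (Set.Icc 0 1) := by
    refine antitoneOn_of_deriv_nonpos (convex_Icc 0 1)
      (fun t _ => (hder t).continuousAt.continuousWithinAt)
      (fun t _ => (hder t).differentiableAt.differentiableWithinAt) fun t ht => ?_
    rw [interior_Icc] at ht
    rw [(hder t).deriv, ← inner_sub_left]
    have h1 := real_inner_le_norm (gradient φ (x + t • d) - gradient φ x) d
    have h2 := hL (x + t • d) x
    rw [add_sub_cancel_left, norm_smul, Real.norm_of_nonneg ht.1.le] at h2
    have h3 := mul_le_mul_of_nonneg_right h2 (norm_nonneg d)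
    linarith
  have := hanti (Set.left_mem_Icc.2 zero_le_one) (Set.right_mem_Icc.2 zero_le_one) zero_le_one
  simp only [h, hdz, zero_smul, add_zero, one_smul, add_sub_cancel] at this
  linarith

end Smooth

/-! ### Convergence of Nesterov's method -/

section Nesterov

variable {n : ℕ} {U : Set (E n)}

lemma proj_mem_and_dist_le (hU : IsClosed U) (hne : U.Nonempty) (z : E n) :
    proj U z ∈ U ∧ ∀ w ∈ U, dist z (proj U z) ≤ dist z w := by
  have : ∃ p, p ∈ U ∧ ∀ w ∈ U, dist z p ≤ dist z w := by
    obtain ⟨p, hp, h⟩ := hU.exists_infDist_eq_dist hne z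
    exact ⟨p, hp, fun w hw => h ▸ Metric.infDist_le_dist_of_mem hw⟩
  exact Classical.epsilon_spec this

lemma inner_sub_proj_le_zero (hU : IsClosed U) (hc : Convex ℝ U) (hne : U.Nonempty)
    (z : E n) {w : E n} (hw : w ∈ U) : ⟪z - proj U z, w - proj U z⟫_ℝ ≤ 0 := by
  obtain ⟨hp, hmin⟩ := proj_mem_and_dist_le hU hne z
  refine (norm_eq_iInf_iff_real_inner_le_zero hc hp).1 ?_ w hw
  have : Nonempty U := ⟨⟨_, hp⟩⟩
  refine le_antisymm (le_ciInf fun v => ?_)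
    (ciInf_le ⟨0, fun _ ⟨_, h⟩ => h ▸ norm_nonneg _⟩ (⟨_, hp⟩ : U))
  simpa [dist_eq_norm] using hmin v v.2

variable {φ : E n → ℝ} {L : ℝ}

/-- The basic inequality of the projected gradient step from `y`. -/
lemma projected_gradient_step_le (hU : IsClosed U) (hc : Convex ℝ U) (hne : U.Nonempty)
    (hφc : ConvexOn ℝ Set.univ φ) (hφd : Differentiable ℝ φ) (hL0 : 0 < L)
    (hL : ∀ u v, ‖gradient φ u - gradient φ v‖ ≤ L * ‖u - v‖) (y : E n) {z : E n} (hz : z ∈ U) :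
    φ (proj U (y - (1 / L) • gradient φ y)) - φ z ≤
      L / 2 * (‖y - z‖ ^ 2 - ‖proj U (y - (1 / L) • gradient φ y) - z‖ ^ 2) := by
  set w := proj U (y - (1 / L) • gradient φ y) with hw
  have h1 := le_add_inner_gradient_add_sq hφd hL y w
  have h2 := hφc.add_inner_gradient_le hφd y z
  have h3 := inner_sub_proj_le_zero hU hc hne (y - (1 / L) • gradient φ y) hz
  rw [← hw] at h3
  have e1 : ⟪y - (1 / L) • gradient φ y - w, z - w⟫_ℝ =
      ⟪y - w, z - w⟫_ℝ - (1 / L) * ⟪gradient φ y, z - w⟫_ℝ := by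
    rw [sub_right_comm, inner_sub_left, real_inner_smul_left]
  have h4 : L * ⟪y - w, z - w⟫_ℝ ≤ ⟪gradient φ y, z - w⟫_ℝ := by
    have := mul_nonpos_of_nonneg_of_nonpos hL0.le (e1 ▸ h3)
    rw [mul_sub, ← mul_assoc, mul_one_div_cancel hL0.ne', one_mul] at this
    linarith
  have e2 : ‖y - z‖ ^ 2 = ‖y - w‖ ^ 2 - 2 * ⟪y - w, z - w⟫_ℝ + ‖w - z‖ ^ 2 := by
    rw [norm_sub_rev w z, ← norm_sub_sq_real, sub_sub_sub_cancel_right]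
  have e3 : ⟪gradient φ y, z - y⟫_ℝ = ⟪gradient φ y, w - y⟫_ℝ + ⟪gradient φ y, z - w⟫_ℝ := by
    rw [← inner_add_right, add_comm, sub_add_sub_cancel]
  rw [norm_sub_rev w y] at h1
  rw [e2]
  linarith

lemma nesterov_projections (φ : E n → ℝ) (U : Set (E n)) (L : ℝ) (v : E n) (j : ℕ) :
    (nesterov φ U L v j).projections = j := by
  induction j with
  | zero => rfl
  | succ j ih => simp [nesterov, ih]

lemma nesterov_point_mem (hU : IsClosed U) {v : E n} (hv : v ∈ U) (φ : E n → ℝ) (L : ℝ) (j : ℕ) :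
    (nesterov φ U L v j).point ∈ U := by
  cases j with
  | zero => exact hv
  | succ j => exact (proj_mem_and_dist_le hU ⟨v, hv⟩ _).1

lemma nesterov_t_sq_sub (φ : E n → ℝ) (U : Set (E n)) (L : ℝ) (v : E n) (j : ℕ) :
    (nesterov φ U L v (j + 1)).t ^ 2 - (nesterov φ U L v (j + 1)).t =
      (nesterov φ U L v j).t ^ 2 := by
  have h : 0 ≤ 1 + 4 * (nesterov φ U L v j).t ^ 2 := by positivity
  have := Real.sq_sqrt h
  simp only [nesterov]
  linarith

lemma le_nesterov_t (φ : E n → ℝ) (U : Set (E n)) (L : ℝ) (v : E n) (j : ℕ) :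
    ((j : ℝ) + 2) / 2 ≤ (nesterov φ U L v j).t := by
  induction j with
  | zero => simp [nesterov]
  | succ j ih =>
    have h : 2 * (nesterov φ U L v j).t ≤ Real.sqrt (1 + 4 * (nesterov φ U L v j).t ^ 2) :=
      Real.le_sqrt_of_sq_le (by nlinarith)
    simp only [nesterov]
    push_cast
    linarith

/-- The Lyapunov function of Nesterov's method, relative to a comparison point `z`. -/
noncomputable def nesterovEnergy (φ : E n → ℝ) (L : ℝ) (z : E n) (s : NesterovState n) : ℝ :=
  (s.t ^ 2 - s.t) * (φ s.point - φ z) + L / 2 * ‖s.t • s.extra - (s.t - 1) • s.point - z‖ ^ 2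

lemma nesterovEnergy_succ_le (hU : IsClosed U) (hc : Convex ℝ U)
    (hφc : ConvexOn ℝ Set.univ φ) (hφd : Differentiable ℝ φ) (hL0 : 0 < L)
    (hL : ∀ u v, ‖gradient φ u - gradient φ v‖ ≤ L * ‖u - v‖) {v z : E n} (hv : v ∈ U)
    (hz : z ∈ U) (j : ℕ) :
    nesterovEnergy φ L z (nesterov φ U L v (j + 1)) ≤
      nesterovEnergy φ L z (nesterov φ U L v j) := by
  have ht' := nesterov_t_sq_sub φ U L v j
  have ht1' := le_nesterov_t φ U L v (j + 1)
  have ht1 := le_nesterov_t φ U L v j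
  have hxU := nesterov_point_mem hU hv φ L j
  unfold nesterovEnergy
  rw [ht']
  have hext : (nesterov φ U L v (j + 1)).extra = (nesterov φ U L v (j + 1)).point +
      (((nesterov φ U L v j).t - 1) / (nesterov φ U L v (j + 1)).t) •
        ((nesterov φ U L v (j + 1)).point - (nesterov φ U L v j).point) := rfl
  have hpt : (nesterov φ U L v (j + 1)).point = proj U ((nesterov φ U L v j).extra -
      (1 / L) • gradient φ (nesterov φ U L v j).extra) := rfl
  have hj : (0 : ℝ) ≤ j := Nat.cast_nonneg j
  push_cast at ht1'
  set w := (nesterov φ U L v (j + 1)).point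
  set y' := (nesterov φ U L v (j + 1)).extra
  set t' := (nesterov φ U L v (j + 1)).t
  set x := (nesterov φ U L v j).point
  set y := (nesterov φ U L v j).extra
  set t := (nesterov φ U L v j).t
  have ht0 : 0 < t := by linarith
  have ht0' : t' ≠ 0 := by linarith
  -- the momentum is chosen so that the vector in the energy is `t w - (t - 1) x`
  have e1 : t' • y' - (t' - 1) • w = t • w - (t - 1) • x := by
    rw [hext, smul_add, smul_smul, mul_div_cancel₀ _ ht0']
    module
  rw [e1]
  -- the step is compared with a point of `U` between `x` and `z`
  let p : E n := (1 - 1 / t) • x + (1 / t) • z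
  have ht2 : 1 / t ≤ 1 := by rw [div_le_one ht0]; linarith
  have hp : p ∈ U := hc hxU hz (by linarith) (by positivity) (by ring)
  have hφp : φ p ≤ (1 - 1 / t) * φ x + (1 / t) * φ z :=
    hφc.2 (Set.mem_univ x) (Set.mem_univ z) (by linarith) (by positivity) (by ring)
  have hstep := projected_gradient_step_le hU hc ⟨v, hv⟩ hφc hφd hL0 hL y hp
  rw [← hpt] at hstep
  have hsq (q : E n) : t ^ 2 * ‖q - p‖ ^ 2 = ‖t • q - (t - 1) • x - z‖ ^ 2 := by
    rw [← mul_pow, ← Real.norm_of_nonneg ht0.le, ← norm_smul, Real.norm_of_nonneg ht0.le]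
    congr 2
    simp only [p, smul_sub, smul_add, smul_smul]
    rw [mul_sub, mul_one_div_cancel ht0.ne', one_smul, mul_one]
    abel
  have h1 := mul_le_mul_of_nonneg_left hstep (sq_nonneg t)
  have h2 := mul_le_mul_of_nonneg_left hφp (sq_nonneg t)
  have e2 : t ^ 2 * ((1 - 1 / t) * φ x + (1 / t) * φ z) = (t ^ 2 - t) * φ x + t * φ z := by
    field_simp
  have e3 : t ^ 2 * (L / 2 * (‖y - p‖ ^ 2 - ‖w - p‖ ^ 2)) =
      L / 2 * ‖t • y - (t - 1) • x - z‖ ^ 2 - L / 2 * ‖t • w - (t - 1) • x - z‖ ^ 2 := by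
    rw [← hsq, ← hsq]; ring
  rw [e3] at h1
  rw [e2] at h2
  linarith

/-- The `O(1 / j²)` convergence rate of Nesterov's method. -/
lemma sq_mul_nesterov_sub_le (hU : IsClosed U) (hc : Convex ℝ U)
    (hφc : ConvexOn ℝ Set.univ φ) (hφd : Differentiable ℝ φ) (hL0 : 0 < L)
    (hL : ∀ u v, ‖gradient φ u - gradient φ v‖ ≤ L * ‖u - v‖) {v z : E n} (hv : v ∈ U)
    (hz : z ∈ U) (hmin : ∀ u ∈ U, φ z ≤ φ u) {j : ℕ} (hj : 1 ≤ j) :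
    ((j : ℝ) + 1) ^ 2 * (φ (nesterov φ U L v j).point - φ z) ≤ 2 * L * ‖v - z‖ ^ 2 := by
  have hE : ∀ i, nesterovEnergy φ L z (nesterov φ U L v i) ≤ L / 2 * ‖v - z‖ ^ 2 := by
    intro i
    induction i with
    | zero => simp [nesterovEnergy, nesterov]
    | succ i ih => exact (nesterovEnergy_succ_le hU hc hφc hφd hL0 hL hv hz i).trans ih
  obtain ⟨i, rfl⟩ := Nat.exists_eq_add_of_le' hj
  have h := hE (i + 1)
  unfold nesterovEnergy at h
  rw [nesterov_t_sq_sub] at h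
  have hge := hmin _ (nesterov_point_mem hU hv φ L (i + 1))
  have ht := le_nesterov_t φ U L v i
  have hi : (0 : ℝ) ≤ i := Nat.cast_nonneg i
  have ht2 : (((i : ℝ) + 2) / 2) ^ 2 ≤ (nesterov φ U L v i).t ^ 2 := by gcongr
  have h1 := mul_le_mul_of_nonneg_right ht2 (sub_nonneg.2 hge)
  have h2 : 0 ≤ L / 2 * ‖(nesterov φ U L v (i + 1)).t • (nesterov φ U L v (i + 1)).extra -
      ((nesterov φ U L v (i + 1)).t - 1) • (nesterov φ U L v (i + 1)).point - z‖ ^ 2 := by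
    positivity
  push_cast
  nlinarith

end Nesterov

namespace Problem

variable {n m : ℕ} {P : Problem n m} {Lf : ℝ}

/-! ### The augmented Lagrangian -/

lemma residual_combo (u v : E n) {a b : ℝ} (hab : a + b = 1) :
    P.residual (a • u + b • v) = a • P.residual u + b • P.residual v := by
  have hg : P.g = a • P.g + b • P.g := by rw [← add_smul, hab, one_smul]
  unfold residual
  nth_rewrite 1 [hg]
  simp only [map_add, map_smul, smul_add]
  abel

lemma lagrangian_zero_left (ρ : ℝ) (u : E n) (y : E m) :
    P.lagrangian 0 ρ u y = P.f u + ⟪y, P.residual u⟫_ℝ + ρ / 2 * ‖P.residual u‖ ^ 2 := by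
  simp [lagrangian]

lemma lagrangian_add_right (ρ : ℝ) (u : E n) (y z : E m) :
    P.lagrangian 0 ρ u (y + z) = P.lagrangian 0 ρ u y + ⟪z, P.residual u⟫_ℝ := by
  rw [lagrangian_zero_left, lagrangian_zero_left, inner_add_left]
  ring

/-- Convexity of `L_{0ρ}(·, y)`, with the strong convexity in the direction of the residual that
the penalty term provides. -/
lemma lagrangian_combo_le (hf : ConvexOn ℝ Set.univ P.f) (ρ : ℝ) (u v : E n) (y : E m) {a b : ℝ}
    (ha : 0 ≤ a) (hb : 0 ≤ b) (hab : a + b = 1) :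
    P.lagrangian 0 ρ (a • u + b • v) y ≤ a * P.lagrangian 0 ρ u y + b * P.lagrangian 0 ρ v y -
      ρ / 2 * (a * b) * ‖P.residual u - P.residual v‖ ^ 2 := by
  have h := hf.2 (Set.mem_univ u) (Set.mem_univ v) ha hb hab
  simp only [smul_eq_mul] at h
  obtain rfl : a = 1 - b := by linarith
  simp only [lagrangian_zero_left, residual_combo u v hab, inner_add_right, inner_smul_right,
    norm_add_sq_real, norm_sub_sq_real, norm_smul, inner_smul_left, Real.norm_of_nonneg ha,
    Real.norm_of_nonneg hb, mul_pow, conj_trivial]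
  linear_combination h

lemma hasGradientAt_lagrangian (hd : Differentiable ℝ P.f) (ρ : ℝ) (y : E m) (u : E n) :
    HasGradientAt (fun u => P.lagrangian 0 ρ u y)
      (gradient P.f u + P.G.adjoint (y + ρ • P.residual u)) u := by
  have hr : HasFDerivAt P.residual P.G u := P.G.hasFDerivAt.add_const P.g
  have h := ((hd u).hasFDerivAt.add ((hasFDerivAt_const y u).inner ℝ hr)).add
    (hr.norm_sq.const_mul (ρ / 2))
  rw [hasGradientAt_iff_hasFDerivAt]
  refine (h.congr_fderiv ?_).congr_of_eventuallyEq
    (Filter.Eventually.of_forall fun v => lagrangian_zero_left ρ v y)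
  ext v
  simp [ContinuousLinearMap.adjoint_inner_left]
  ring

lemma differentiable_lagrangian (hd : Differentiable ℝ P.f) (ρ : ℝ) (y : E m) :
    Differentiable ℝ (fun u => P.lagrangian 0 ρ u y) :=
  fun u => (hasGradientAt_lagrangian hd ρ y u).differentiableAt

lemma convexOn_lagrangian (hf : ConvexOn ℝ Set.univ P.f) {ρ : ℝ} (hρ : 0 ≤ ρ) (y : E m) :
    ConvexOn ℝ Set.univ (fun u => P.lagrangian 0 ρ u y) := by
  refine ⟨convex_univ, fun u _ v _ a b ha hb hab => ?_⟩
  have := lagrangian_combo_le hf ρ u v y ha hb hab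
  have h0 : 0 ≤ ρ / 2 * (a * b) * ‖P.residual u - P.residual v‖ ^ 2 := by positivity
  simp only [smul_eq_mul]
  linarith

lemma norm_gradient_lagrangian_sub_le (hP : P.Assumptions Lf) {ρ : ℝ} (hρ : 0 ≤ ρ) (y : E m)
    (u v : E n) :
    ‖gradient (fun u => P.lagrangian 0 ρ u y) u - gradient (fun u => P.lagrangian 0 ρ u y) v‖ ≤
      P.lipLagrangian Lf ρ * ‖u - v‖ := by
  rw [(hasGradientAt_lagrangian hP.differentiable_f ρ y u).gradient,
    (hasGradientAt_lagrangian hP.differentiable_f ρ y v).gradient]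
  have e : gradient P.f u + P.G.adjoint (y + ρ • P.residual u) -
      (gradient P.f v + P.G.adjoint (y + ρ • P.residual v)) =
      (gradient P.f u - gradient P.f v) + ρ • P.G.adjoint (P.G (u - v)) := by
    simp only [residual, map_add, map_sub, map_smul, smul_add, smul_sub]
    abel
  have h1 : ‖P.G.adjoint (P.G (u - v))‖ ≤ ‖P.G‖ * (‖P.G‖ * ‖u - v‖) := by
    refine (P.G.adjoint.le_opNorm _).trans ?_
    rw [LinearIsometryEquiv.norm_map]
    gcongr
    exact P.G.le_opNorm _
  rw [e]
  refine (norm_add_le _ _).trans ?_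
  rw [norm_smul, Real.norm_of_nonneg hρ, lipLagrangian]
  have h2 := hP.lipschitz_gradient u v
  have h3 := mul_le_mul_of_nonneg_left h1 hρ
  linarith

lemma lipLagrangian_pos (hP : P.Assumptions Lf) {ρ : ℝ} (hρ : 0 ≤ ρ) :
    0 < P.lipLagrangian Lf ρ := by
  have := hP.Lf_pos
  unfold lipLagrangian
  positivity

/-! ### The smoothed dual and primal functions -/

lemma Assumptions.isCompact_U (hP : P.Assumptions Lf) : IsCompact P.U :=
  Metric.isCompact_of_isClosed_isBounded hP.closed_U hP.bounded_U

lemma exists_lagrangian_eq_smoothDual (hP : P.Assumptions Lf) (ρ : ℝ) (y : E m) :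
    ∃ u ∈ P.U, P.lagrangian 0 ρ u y = P.smoothDual ρ y ∧
      ∀ v ∈ P.U, P.lagrangian 0 ρ u y ≤ P.lagrangian 0 ρ v y := by
  obtain ⟨u, hu, hmin⟩ := hP.isCompact_U.exists_isMinOn hP.nonempty_U
    (differentiable_lagrangian hP.differentiable_f ρ y).continuous.continuousOn
  refine ⟨u, hu, ?_, fun v hv => hmin hv⟩
  symm
  refine IsLeast.csInf_eq ⟨⟨u, hu, rfl⟩, ?_⟩
  rintro _ ⟨v, hv, rfl⟩
  exact hmin hv

lemma smoothDual_le_lagrangian (hP : P.Assumptions Lf) (ρ : ℝ) (y : E m) {u : E n}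
    (hu : u ∈ P.U) : P.smoothDual ρ y ≤ P.lagrangian 0 ρ u y := by
  obtain ⟨v, -, h, hmin⟩ := exists_lagrangian_eq_smoothDual hP ρ y
  exact h ▸ hmin u hu

lemma smoothDual_mono (hP : P.Assumptions Lf) {ρ ρ' : ℝ} (h : ρ ≤ ρ') (y : E m) :
    P.smoothDual ρ y ≤ P.smoothDual ρ' y := by
  obtain ⟨v, hv, e, -⟩ := exists_lagrangian_eq_smoothDual hP ρ' y
  refine (smoothDual_le_lagrangian hP ρ y hv).trans ?_
  rw [← e, lagrangian_zero_left, lagrangian_zero_left]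
  gcongr

/-- Weak duality. -/
lemma smoothDual_le_optValue (hP : P.Assumptions Lf) (ρ : ℝ) (y : E m) :
    P.smoothDual ρ y ≤ P.optValue := by
  obtain ⟨u, hu, hmin⟩ := hP.exists_optimal
  have e : P.optValue = P.f u := by
    refine IsLeast.csInf_eq ⟨⟨u, hu, rfl⟩, ?_⟩
    rintro _ ⟨v, hv, rfl⟩
    exact hmin v hv
  have := smoothDual_le_lagrangian hP ρ y hu.1
  rw [lagrangian_zero_left, hu.2] at this
  simpa [e] using this

lemma IsOptimalMultiplier.optValue_le (hP : P.Assumptions Lf) {xs : E m}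
    (hxs : P.IsOptimalMultiplier xs) {u : E n} (hu : u ∈ P.U) :
    P.optValue ≤ P.f u + ‖xs‖ * ‖P.residual u‖ := by
  have h := smoothDual_le_lagrangian hP 0 xs hu
  rw [hxs, lagrangian_zero_left] at h
  have := real_inner_le_norm xs (P.residual u)
  linarith

lemma lagrangian_eq_sub_sq {μ : ℝ} (hμ : 0 < μ) (u : E n) (x : E m) :
    P.lagrangian μ 0 u x = P.f u + ‖P.residual u‖ ^ 2 / (2 * μ) -
      μ / 2 * ‖x - (1 / μ) • P.residual u‖ ^ 2 := by
  rw [lagrangian, norm_sub_sq_real, norm_smul, inner_smul_right,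
    Real.norm_of_nonneg (by positivity)]
  field_simp
  ring

lemma smoothPrimal_eq {μ : ℝ} (hμ : 0 < μ) (u : E n) :
    P.smoothPrimal μ u = P.f u + ‖P.residual u‖ ^ 2 / (2 * μ) := by
  have hle (x : E m) : P.lagrangian μ 0 u x ≤ P.f u + ‖P.residual u‖ ^ 2 / (2 * μ) := by
    rw [lagrangian_eq_sub_sq hμ]
    have : 0 ≤ μ / 2 * ‖x - (1 / μ) • P.residual u‖ ^ 2 := by positivity
    linarith
  refine le_antisymm (ciSup_le hle) ?_
  refine le_trans (le_of_eq ?_) (le_ciSup ⟨_, Set.forall_mem_range.2 hle⟩ ((1 / μ) • P.residual u))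
  rw [lagrangian_eq_sub_sq hμ]
  simp

lemma smoothPrimal_anti {μ μ' : ℝ} (hμ : 0 < μ) (h : μ ≤ μ') (u : E n) :
    P.smoothPrimal μ' u ≤ P.smoothPrimal μ u := by
  rw [smoothPrimal_eq hμ, smoothPrimal_eq (hμ.trans_le h)]
  gcongr

/-! ### The inner solver -/

lemma inner_mem_U (hP : P.Assumptions Lf) (ρ : ℝ) (y : E m) {v : E n} (hv : v ∈ P.U) (j : ℕ) :
    (P.inner Lf ρ y v j).point ∈ P.U :=
  nesterov_point_mem hP.closed_U hv _ _ j

/-- The number of iterations fixed in advance suffices for the accuracy `δ`. -/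
lemma isInnerSolution_innerBudget (hP : P.Assumptions Lf) {ρ δ : ℝ} (hρ : 0 ≤ ρ) (hδ : 0 < δ)
    (y : E m) {v : E n} (hv : v ∈ P.U) :
    P.IsInnerSolution ρ δ y (P.inner Lf ρ y v (P.innerBudget Lf ρ δ)).point := by
  refine ⟨inner_mem_U hP ρ y hv _, ?_⟩
  obtain ⟨z, hz, hzd, hmin⟩ := exists_lagrangian_eq_smoothDual hP ρ y
  have hL := lipLagrangian_pos hP hρ
  have hrate := sq_mul_nesterov_sub_le hP.closed_U hP.convex_U (convexOn_lagrangian hP.convex_f hρ y)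
    (differentiable_lagrangian hP.differentiable_f ρ y) hL
    (norm_gradient_lagrangian_sub_le hP hρ y) hv hz hmin
    (le_max_left 1 _ : 1 ≤ P.innerBudget Lf ρ δ)
  rw [hzd] at hrate
  change ((P.innerBudget Lf ρ δ : ℝ) + 1) ^ 2 * (P.lagrangian 0 ρ (P.inner Lf ρ y v
    (P.innerBudget Lf ρ δ)).point y - P.smoothDual ρ y) ≤ _ at hrate
  set gap := P.lagrangian 0 ρ (P.inner Lf ρ y v (P.innerBudget Lf ρ δ)).point y -
    P.smoothDual ρ y
  set L := P.lipLagrangian Lf ρ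
  set D := Metric.diam P.U
  set j : ℝ := (P.innerBudget Lf ρ δ : ℝ)
  have hD : ‖v - z‖ ≤ D := by
    rw [← dist_eq_norm]
    exact Metric.dist_le_diam_of_mem hP.bounded_U hv hz
  have hD0 : 0 ≤ D := Metric.diam_nonneg
  have hj0 : 0 ≤ j := Nat.cast_nonneg _
  have hj : 2 * D * Real.sqrt (L / δ) ≤ j + 1 := by
    refine (Nat.lt_floor_add_one _).le.trans ?_
    have : ⌊2 * D * Real.sqrt (L / δ)⌋₊ ≤ P.innerBudget Lf ρ δ := le_max_right _ _
    exact add_le_add_left (Nat.cast_le.2 this) 1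
  have hj2 : 4 * D ^ 2 * L ≤ δ * (j + 1) ^ 2 := by
    have h : (2 * D * Real.sqrt (L / δ)) ^ 2 ≤ (j + 1) ^ 2 := by gcongr
    rw [mul_pow, Real.sq_sqrt (by positivity)] at h
    have h' := mul_le_mul_of_nonneg_left h hδ.le
    have e : δ * ((2 * D) ^ 2 * (L / δ)) = 4 * D ^ 2 * L := by field_simp; ring
    rwa [e] at h'
  have hvz : 2 * L * ‖v - z‖ ^ 2 ≤ 2 * L * D ^ 2 := by gcongr
  have hDL : 0 ≤ D ^ 2 * L := by positivity
  have hpos : 0 < (j + 1) ^ 2 := by positivity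
  refine le_of_mul_le_mul_left ?_ hpos
  linarith

lemma InnerStop.isInnerSolution (hP : P.Assumptions Lf) {ρ δ : ℝ} (hρ : 0 ≤ ρ) (hδ : 0 < δ)
    {y : E m} {v : E n} (hv : v ∈ P.U) {j : ℕ} (hj : P.InnerStop Lf ρ δ y v j) :
    P.IsInnerSolution ρ δ y (P.inner Lf ρ y v j).point := by
  obtain hj | rfl := hj
  · exact hj.1
  · exact isInnerSolution_innerBudget hP hρ hδ y hv

lemma InnerStop.le_innerBudget (hP : P.Assumptions Lf) {ρ δ : ℝ} (hρ : 0 ≤ ρ) (hδ : 0 < δ)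
    {y : E m} {v : E n} (hv : v ∈ P.U) {j : ℕ} (hj : P.InnerStop Lf ρ δ y v j) :
    j ≤ P.innerBudget Lf ρ δ := by
  obtain hj | rfl := hj
  · exact hj.2 (isInnerSolution_innerBudget hP hρ hδ y hv)
  · exact le_rfl

/-! ### The smoothed duality gap in one iteration -/

/-- The inexact dual step `y ↦ y + ρ (G w + g)` raises the smoothed dual function at least to the
value `L_{0ρ}(w, y)` attained by the inner solver, up to twice the inner accuracy. The bound follows from strong convexity at the midpoint of `w` and an
arbitrary point of `U`. -/
lemma IsInnerSolution.lagrangian_le_smoothDual (hP : P.Assumptions Lf) {ρ δ : ℝ} (hρ : 0 ≤ ρ)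
    {y : E m} {w : E n} (hw : P.IsInnerSolution ρ δ y w) :
    P.lagrangian 0 ρ w y ≤ P.smoothDual ρ (y + ρ • P.residual w) + 2 * δ := by
  obtain ⟨v, hv, e, -⟩ := exists_lagrangian_eq_smoothDual hP ρ (y + ρ • P.residual w)
  rw [← e, lagrangian_add_right, inner_smul_left, conj_trivial]
  have h1 := lagrangian_combo_le hP.convex_f ρ w v y (a := 1 / 2) (b := 1 / 2)
    (by norm_num) (by norm_num) (by norm_num)
  have h2 := smoothDual_le_lagrangian hP ρ y
    (hP.convex_U hw.1 hv (a := 1 / 2) (b := 1 / 2) (by norm_num) (by norm_num) (by norm_num))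
  have h3 := hw.2
  have h4 := norm_add_sq_real (P.residual w) (P.residual v)
  have h5 := norm_sub_sq_real (P.residual w) (P.residual v)
  -- the two quadratic terms add up to `ρ / 4 * ‖r w + r v‖ ^ 2`
  have h6 : 0 ≤ ρ / 4 * ‖P.residual w + P.residual v‖ ^ 2 := by positivity
  rw [h4] at h6
  rw [h5] at h1
  linarith

/-- The excessive gap estimate: one iteration contracts the smoothed duality gap `Γ` by `1 - τ`,
up to the inner error, while `μ` decreases by the same factor. -/
lemma smoothPrimal_sub_smoothDual_le (hP : P.Assumptions Lf) {ρ μ τ δ Γ : ℝ} (hρ : 0 ≤ ρ)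
    (hμ : 0 < μ) (hτ0 : 0 ≤ τ) (hτ1 : τ < 1) (hτ : τ ≤ (1 - τ) * (ρ * μ)) {u w : E n} {x : E m}
    (hgap : P.smoothPrimal μ u - P.smoothDual ρ x ≤ Γ)
    (hw : P.IsInnerSolution ρ δ (P.hatX μ τ u x) w) :
    P.smoothPrimal ((1 - τ) * μ) ((1 - τ) • u + τ • w) -
      P.smoothDual ρ (P.hatX μ τ u x + ρ • P.residual w) ≤ (1 - τ) * Γ + 2 * δ := by
  have h1τ : 0 < 1 - τ := by linarith
  have hdual := hw.lagrangian_le_smoothDual hP hρ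
  suffices h : P.smoothPrimal ((1 - τ) * μ) ((1 - τ) • u + τ • w) ≤
      (1 - τ) * Γ + P.lagrangian 0 ρ w (P.hatX μ τ u x) by linarith
  have hx := smoothDual_le_lagrangian hP ρ x hw.1
  have hf := hP.convex_f.2 (Set.mem_univ u) (Set.mem_univ w) h1τ.le hτ0 (by ring)
  rw [smoothPrimal_eq hμ] at hgap
  rw [smoothPrimal_eq (by positivity), residual_combo u w (by ring)]
  rw [lagrangian_zero_left] at hx ⊢
  set r := P.residual u
  set s := P.residual w
  simp only [smul_eq_mul] at hf
  have e1 : ⟪P.hatX μ τ u x, s⟫_ℝ = (1 - τ) * ⟪x, s⟫_ℝ + τ / μ * ⟪r, s⟫_ℝ := by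
    simp [hatX, inner_add_left, inner_smul_left, r]
  have e2 : ‖(1 - τ) • r + τ • s‖ ^ 2 / (2 * ((1 - τ) * μ)) =
      (1 - τ) * (‖r‖ ^ 2 / (2 * μ)) + τ / μ * ⟪r, s⟫_ℝ +
        τ ^ 2 / (2 * ((1 - τ) * μ)) * ‖s‖ ^ 2 := by
    rw [norm_add_sq_real, norm_smul, norm_smul, inner_smul_left, inner_smul_right,
      Real.norm_of_nonneg h1τ.le, Real.norm_of_nonneg hτ0, conj_trivial]
    field_simp
  -- the condition `hτ` lets the penalty term absorb the remaining quadratic term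
  have e3 : τ ^ 2 / (2 * ((1 - τ) * μ)) * ‖s‖ ^ 2 ≤ τ * (ρ / 2) * ‖s‖ ^ 2 := by
    gcongr
    rw [div_le_iff₀ (by positivity)]
    nlinarith
  rw [e1, e2]
  have h1 := mul_le_mul_of_nonneg_left hgap h1τ.le
  have h2 := mul_le_mul_of_nonneg_left hx h1τ.le
  linarith

/-- A small smoothed duality gap bounds the objective error. -/
lemma f_sub_optValue_le (hP : P.Assumptions Lf) {ρ μ Γ : ℝ} (hμ : 0 < μ) {u : E n} {x : E m}
    (hgap : P.smoothPrimal μ u - P.smoothDual ρ x ≤ Γ) : P.f u - P.optValue ≤ Γ := by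
  have h := smoothDual_le_optValue hP ρ x
  rw [smoothPrimal_eq hμ] at hgap
  have : 0 ≤ ‖P.residual u‖ ^ 2 / (2 * μ) := by positivity
  linarith

/-- A small smoothed duality gap bounds the infeasibility. -/
lemma sq_norm_residual_le (hP : P.Assumptions Lf) {ρ μ Γ : ℝ} (hμ : 0 < μ) {u : E n} {x xs : E m}
    (hu : u ∈ P.U) (hxs : P.IsOptimalMultiplier xs)
    (hgap : P.smoothPrimal μ u - P.smoothDual ρ x ≤ Γ) :
    ‖P.residual u‖ ^ 2 ≤ 2 * μ * (Γ + ‖xs‖ * ‖P.residual u‖) := by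
  have h := smoothDual_le_optValue hP ρ x
  have h' := hxs.optValue_le hP hu
  rw [smoothPrimal_eq hμ] at hgap
  have : ‖P.residual u‖ ^ 2 / (2 * μ) ≤ Γ + ‖xs‖ * ‖P.residual u‖ := by linarith
  rwa [div_le_iff₀' (by positivity)] at this

end Problem

/-! ### Counting projections -/

lemma two_mul_mul_sqrt_le {l ρ ε D a : ℝ} (hl : 0 ≤ l) (hρ : 0 ≤ ρ) (hε : 0 < ε) (hD : 0 ≤ D)
    (ha : 0 ≤ a) :
    2 * D * Real.sqrt ((l + ρ * a ^ 2) / (ε / 6)) ≤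
      Real.sqrt (24 * l * D ^ 2 / ε) + Real.sqrt (24 / ε) * D * a * Real.sqrt ρ := by
  have h0 : 0 ≤ Real.sqrt (24 * l * D ^ 2 / ε) := Real.sqrt_nonneg _
  have h1 : 0 ≤ Real.sqrt (24 / ε) * D * a * Real.sqrt ρ := by positivity
  rw [← pow_le_pow_iff_left₀ (by positivity) (by positivity) two_ne_zero, add_sq]
  simp only [mul_pow]
  rw [Real.sq_sqrt (by positivity), Real.sq_sqrt (by positivity), Real.sq_sqrt (by positivity),
    Real.sq_sqrt hρ]
  have e : 2 ^ 2 * D ^ 2 * ((l + ρ * a ^ 2) / (ε / 6)) =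
      24 * l * D ^ 2 / ε + 24 / ε * D ^ 2 * a ^ 2 * ρ := by
    field_simp
    ring
  rw [e]
  nlinarith

lemma sum_sqrt_two_pow_mul_le (ρ : ℝ) (K : ℕ) :
    ∑ k ∈ Finset.range K, Real.sqrt (2 ^ k * ρ) ≤ 5 * Real.sqrt (2 ^ K * ρ) := by
  induction K with
  | zero => simp [Real.sqrt_nonneg]
  | succ K ih =>
    have h2 : (6 / 5 : ℝ) ≤ Real.sqrt 2 := Real.le_sqrt_of_sq_le (by norm_num)
    have h := mul_le_mul_of_nonneg_right h2 (Real.sqrt_nonneg (2 ^ K * ρ))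
    rw [Finset.sum_range_succ, pow_succ', mul_assoc, Real.sqrt_mul zero_le_two]
    linarith

/-- The total cost of the penalty terms is a geometric series, dominated by its last term. -/
lemma sum_penalty_cost_le {ρ ε X c : ℝ} (hε : 0 < ε) (hX : 0 ≤ X) (hc : 0 ≤ c) {K : ℕ}
    (hK : ε * (2 ^ K * ρ) ≤ 32 * X ^ 2) :
    ∑ k ∈ Finset.range K, Real.sqrt (24 / ε) * c * Real.sqrt (2 ^ k * ρ) ≤
      80 * Real.sqrt 3 * c * X / ε := by
  rw [← Finset.mul_sum]
  have h1 : 2 ^ K * ρ ≤ 32 * X ^ 2 / ε := by rwa [le_div_iff₀' hε]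
  have h2 : Real.sqrt (24 / ε) * Real.sqrt (32 * X ^ 2 / ε) = 16 * Real.sqrt 3 * X / ε := by
    rw [← Real.sqrt_mul (by positivity), Real.sqrt_eq_iff_mul_self_eq (by positivity)
      (by positivity)]
    field_simp
    rw [Real.sq_sqrt (by norm_num)]
    ring
  calc Real.sqrt (24 / ε) * c * ∑ k ∈ Finset.range K, Real.sqrt (2 ^ k * ρ)
      ≤ Real.sqrt (24 / ε) * c * (5 * Real.sqrt (32 * X ^ 2 / ε)) := by
        gcongr
        exact (sum_sqrt_two_pow_mul_le ρ K).trans (by gcongr)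
    _ = 5 * c * (Real.sqrt (24 / ε) * Real.sqrt (32 * X ^ 2 / ε)) := by ring
    _ = 80 * Real.sqrt 3 * c * X / ε := by rw [h2]; ring

namespace Problem

variable {n m : ℕ} {P : Problem n m} {Lf : ℝ}

lemma innerBudget_le (ρ δ : ℝ) :
    (P.innerBudget Lf ρ δ : ℝ) ≤
      max 1 (2 * Metric.diam P.U * Real.sqrt (P.lipLagrangian Lf ρ / δ)) := by
  have h : 0 ≤ 2 * Metric.diam P.U * Real.sqrt (P.lipLagrangian Lf ρ / δ) :=
    mul_nonneg (mul_nonneg zero_le_two Metric.diam_nonneg) (Real.sqrt_nonneg _)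
  rw [innerBudget, Nat.cast_max, Nat.cast_one]
  exact max_le_max le_rfl (Nat.floor_le h)

/-- A small smoothed duality gap for a large penalty parameter forces near-feasibility. -/
lemma norm_residual_le_of_gap_le (hP : P.Assumptions Lf) {ρ ε : ℝ} (hρ : 0 < ρ) (hε : 0 < ε)
    {u : E n} {x xs : E m} (hu : u ∈ P.U) (hxs : P.IsOptimalMultiplier xs) (hxs2 : 2 ≤ ‖xs‖)
    (hgap : P.smoothPrimal (1 / 3 * (4 / ρ)) u - P.smoothDual ρ x ≤ ε / 2)
    (hlarge : 4 * ‖xs‖ ^ 2 < ε * ρ) : ‖P.residual u‖ ≤ ε := by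
  have h := sq_norm_residual_le hP (by positivity) hu hxs hgap
  by_contra! hlt
  set s := ‖P.residual u‖
  set X := ‖xs‖
  have hs : 0 < s := hε.trans hlt
  have h1 : 3 * ρ * s ^ 2 ≤ 8 * (ε / 2 + X * s) := by
    have := mul_le_mul_of_nonneg_left h (by positivity : 0 ≤ 3 * ρ)
    refine this.trans_eq ?_
    field_simp
    ring
  have h2 : 3 * ρ * s < 4 + 8 * X := by
    refine lt_of_mul_lt_mul_right ?_ hs.le
    linarith
  have h3 : ρ * ε < ρ * s := by gcongr
  nlinarith

namespace AIFALRun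

variable {ρ₀ ε : ℝ} (R : P.AIFALRun Lf ρ₀ ε)

/-! ### Runs of the adaptive algorithm -/

/-- The algorithm does not stop in the first `k` iterations. -/
def Continues (k : ℕ) : Prop := ∀ i, 1 ≤ i → i ≤ k → ε < ‖P.residual (R.u i)‖

variable {R}

lemma innerState_projections (k : ℕ) : (R.innerState k).projections = R.steps k :=
  nesterov_projections _ _ _ _ _

lemma Continues.isInnerSolution (hP : P.Assumptions Lf) (hρ₀ : 0 < ρ₀) (hε : 0 < ε) {k : ℕ}
    (hk : R.Continues k) :
    P.IsInnerSolution (2 ^ k * ρ₀) (ε / 6) (R.callPoint k) (R.innerState k).point := by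
  obtain ⟨hv, hcall, -⟩ := R.step k hk
  rw [delta_zero] at hcall
  exact hcall.isInnerSolution hP (by positivity) (by positivity) hv

lemma Continues.steps_le (hP : P.Assumptions Lf) (hρ₀ : 0 < ρ₀) (hε : 0 < ε) {k : ℕ}
    (hk : R.Continues k) : R.steps k ≤ P.innerBudget Lf (2 ^ k * ρ₀) (ε / 6) := by
  obtain ⟨hv, hcall, -⟩ := R.step k hk
  rw [delta_zero] at hcall
  exact hcall.le_innerBudget hP (by positivity) (by positivity) hv

/-- One outer iteration preserves the bound `ε / 2` on the smoothed duality gap, while `μ` is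
divided by `3`. -/
lemma Continues.gap_succ_le (hP : P.Assumptions Lf) (hρ₀ : 0 < ρ₀) (hε : 0 < ε) {k : ℕ}
    (hk : R.Continues k) (hu : R.u k ∈ P.U)
    (hgap : P.smoothPrimal (4 / (2 ^ k * ρ₀)) (R.u k) - P.smoothDual (2 ^ k * ρ₀) (R.x k) ≤
      ε / 2) :
    R.u (k + 1) ∈ P.U ∧ P.smoothPrimal (1 / 3 * (4 / (2 ^ k * ρ₀))) (R.u (k + 1)) -
      P.smoothDual (2 ^ k * ρ₀) (R.x (k + 1)) ≤ ε / 2 := by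
  have hw := hk.isInnerSolution hP hρ₀ hε
  obtain ⟨-, -, hu', hx'⟩ := R.step k hk
  change R.u (k + 1) = (1 - tau 0) • R.u k + tau 0 • (R.innerState k).point at hu'
  change R.x (k + 1) = R.callPoint k + (2 ^ k * ρ₀) • P.residual (R.innerState k).point at hx'
  have hρ : 0 < 2 ^ k * ρ₀ := by positivity
  have h := smoothPrimal_sub_smoothDual_le hP hρ.le (by positivity) (τ := tau 0)
    (by norm_num [tau_zero]) (by norm_num [tau_zero])
    (by rw [mul_div_cancel₀ _ hρ.ne', tau_zero]; norm_num) hgap hw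
  rw [hu', hx']
  refine ⟨hP.convex_U hu hw.1 (by norm_num [tau_zero]) (by norm_num [tau_zero]) (by ring), ?_⟩
  change P.smoothPrimal _ _ - P.smoothDual _ (R.callPoint k + _) ≤ _ at h
  rw [show 1 - tau 0 = 1 / 3 by norm_num [tau_zero]] at h ⊢
  linarith

lemma Continues.gap_le (hP : P.Assumptions Lf) (hρ₀ : 0 < ρ₀) (hε : 0 < ε) {k : ℕ}
    (hk : R.Continues k) :
    R.u k ∈ P.U ∧
      P.smoothPrimal (4 / (2 ^ k * ρ₀)) (R.u k) - P.smoothDual (2 ^ k * ρ₀) (R.x k) ≤ ε / 2 := by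
  induction k with
  | zero =>
    have := R.init_gap
    rw [delta_zero] at this
    refine ⟨R.u_zero_mem, ?_⟩
    rw [pow_zero, one_mul]
    linarith
  | succ k ih =>
    have hk' : R.Continues k := fun i h1 h2 => hk i h1 (h2.trans k.le_succ)
    obtain ⟨hu, hgap⟩ := ih hk'
    obtain ⟨hu', hgap'⟩ := hk'.gap_succ_le hP hρ₀ hε hu hgap
    refine ⟨hu', ?_⟩
    -- the next parameters `μ / 2` and `2 ρ` are no less favourable than `μ / 3` and `ρ`
    have h1 : P.smoothDual (2 ^ k * ρ₀) (R.x (k + 1)) ≤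
        P.smoothDual (2 ^ (k + 1) * ρ₀) (R.x (k + 1)) := by
      refine smoothDual_mono hP ?_ _
      gcongr
      · norm_num
      · exact k.le_succ
    have h2 : P.smoothPrimal (4 / (2 ^ (k + 1) * ρ₀)) (R.u (k + 1)) ≤
        P.smoothPrimal (1 / 3 * (4 / (2 ^ k * ρ₀))) (R.u (k + 1)) := by
      refine smoothPrimal_anti (by positivity) ?_ _
      have e : 4 / (2 ^ (k + 1) * ρ₀) = 1 / 2 * (4 / (2 ^ k * ρ₀)) := by
        field_simp
        ring
      rw [e]
      gcongr
      norm_num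
    linarith

/-- As long as the algorithm does not stop, the penalty parameter is bounded. -/
lemma Continues.mul_two_pow_le (hP : P.Assumptions Lf) (hρ₀ : 0 < ρ₀) (hε : 0 < ε) {xs : E m}
    (hxs : P.IsOptimalMultiplier xs) (hxs2 : 2 ≤ ‖xs‖) {k : ℕ} (hk1 : 1 ≤ k)
    (hk : R.Continues k) : ε * (2 ^ (k + 1) * ρ₀) ≤ 16 * ‖xs‖ ^ 2 := by
  obtain ⟨k, rfl⟩ := Nat.exists_eq_add_of_le' hk1
  by_contra! hlt
  have hk' : R.Continues k := fun i h1 h2 => hk i h1 (h2.trans k.le_succ)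
  obtain ⟨hu, hgap⟩ := hk'.gap_le hP hρ₀ hε
  obtain ⟨hu', hgap'⟩ := hk'.gap_succ_le hP hρ₀ hε hu hgap
  have e : (2 : ℝ) ^ (k + 1 + 1) = 4 * 2 ^ k := by ring
  rw [e] at hlt
  exact (hk (k + 1) hk1 le_rfl).not_ge
    (norm_residual_le_of_gap_le hP (by positivity) hε hu' hxs hxs2 hgap' (by linarith))

lemma StopsAt.continues {K : ℕ} (hK : R.StopsAt K) {k : ℕ} (hk : k < K) : R.Continues k := by
  intro i h1 h2
  by_contra! h
  exact (hK.2 ⟨h1, h⟩).not_gt (h2.trans_lt hk)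

lemma exists_stopsAt (hP : P.Assumptions Lf) (hρ₀ : 0 < ρ₀) (hε : 0 < ε) {xs : E m}
    (hxs : P.IsOptimalMultiplier xs) (hxs2 : 2 ≤ ‖xs‖) (R : P.AIFALRun Lf ρ₀ ε) :
    ∃ K, R.StopsAt K := by
  classical
  have h : ∃ k, 1 ≤ k ∧ ‖P.residual (R.u k)‖ ≤ ε := by
    by_contra! h
    obtain ⟨k, hk⟩ := pow_unbounded_of_one_lt (16 * ‖xs‖ ^ 2 / (ε * ρ₀)) (one_lt_two (α := ℝ))
    rw [div_lt_iff₀ (by positivity)] at hk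
    have h1 := Continues.mul_two_pow_le hP hρ₀ hε hxs hxs2 (Nat.le_add_left 1 k)
      (fun i h1 _ => h i h1 : R.Continues (k + 1))
    have h2 : (2 : ℝ) ^ k ≤ 2 ^ (k + 1 + 1) := pow_le_pow_right₀ one_le_two (by omega)
    have h3 := mul_le_mul_of_nonneg_right h2 (mul_pos hε hρ₀).le
    linarith
  exact ⟨Nat.find h, Nat.find_spec h, fun k hk => Nat.find_min' h hk⟩

lemma StopsAt.one_lt_imp_mul_two_pow_le (hP : P.Assumptions Lf) (hρ₀ : 0 < ρ₀) (hε : 0 < ε)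
    {xs : E m} (hxs : P.IsOptimalMultiplier xs) (hxs2 : 2 ≤ ‖xs‖) {K : ℕ} (hK : R.StopsAt K)
    (h1 : 1 < K) : ε * (2 ^ K * ρ₀) ≤ 16 * ‖xs‖ ^ 2 := by
  obtain ⟨k, rfl⟩ := Nat.exists_eq_add_of_le' h1.le
  exact (hK.continues k.lt_succ_self).mul_two_pow_le hP hρ₀ hε hxs hxs2 (by omega)

lemma StopsAt.le_max_logb (hP : P.Assumptions Lf) (hρ₀ : 0 < ρ₀) (hε : 0 < ε) {xs : E m}
    (hxs : P.IsOptimalMultiplier xs) (hxs2 : 2 ≤ ‖xs‖) {K : ℕ} (hK : R.StopsAt K) :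
    (K : ℝ) ≤ max 1 (Real.logb 2 (16 * ‖xs‖ ^ 2 / (ε * ρ₀))) := by
  rcases Nat.lt_or_ge 1 K with h1 | h1
  · refine le_max_of_le_right ?_
    have h := hK.one_lt_imp_mul_two_pow_le hP hρ₀ hε hxs hxs2 h1
    rw [Real.le_logb_iff_rpow_le one_lt_two (by positivity), Real.rpow_natCast,
      le_div_iff₀ (by positivity)]
    linarith
  · exact le_max_of_le_left (by exact_mod_cast h1)

lemma StopsAt.isEpsOptimal (hP : P.Assumptions Lf) (hρ₀ : 0 < ρ₀) (hε : 0 < ε) {K : ℕ}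
    (hK : R.StopsAt K) : P.IsEpsOptimal ε (R.u K) := by
  obtain ⟨h1, hres⟩ := hK.1
  obtain ⟨k, rfl⟩ := Nat.exists_eq_add_of_le' h1
  have hk := hK.continues k.lt_succ_self
  obtain ⟨hu, hgap⟩ := hk.gap_le hP hρ₀ hε
  obtain ⟨hu', hgap'⟩ := hk.gap_succ_le hP hρ₀ hε hu hgap
  have := f_sub_optValue_le hP (by positivity) hgap'
  exact ⟨hu', by linarith, hres⟩

/-- If `A` dominates the part of each inner budget that does not come from the penalty term, then
the number of projections is at most `K A` plus the cost of the penalty terms. -/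
lemma StopsAt.totalProjections_le (hP : P.Assumptions Lf) (hρ₀ : 0 < ρ₀) (hε : 0 < ε) {xs : E m}
    (hxs : P.IsOptimalMultiplier xs) (hxs2 : 2 ≤ ‖xs‖) {K : ℕ} (hK : R.StopsAt K)
    (hle : ρ₀ ≤ 16 * ‖xs‖ ^ 2 / ε) {A : ℝ}
    (hA : ∀ k, max 1 (2 * Metric.diam P.U *
      Real.sqrt (P.lipLagrangian Lf (2 ^ k * ρ₀) / (ε / 6))) ≤
        A + Real.sqrt (24 / ε) * (Metric.diam P.U * ‖P.G‖) * Real.sqrt (2 ^ k * ρ₀)) :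
    (R.totalProjections K : ℝ) ≤
      K * A + 80 * Real.sqrt 3 * Metric.diam P.U * ‖P.G‖ * ‖xs‖ / ε := by
  have hK32 : ε * (2 ^ K * ρ₀) ≤ 32 * ‖xs‖ ^ 2 := by
    rcases hK.1.1.lt_or_eq with h1 | rfl
    · have h := hK.one_lt_imp_mul_two_pow_le hP hρ₀ hε hxs hxs2 h1
      have : 0 ≤ ‖xs‖ ^ 2 := by positivity
      linarith
    · rw [le_div_iff₀ hε] at hle
      linarith
  have hsum := sum_penalty_cost_le hε (norm_nonneg xs)
    (mul_nonneg (Metric.diam_nonneg (s := P.U)) (norm_nonneg P.G)) hK32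
  have hN : (R.totalProjections K : ℝ) ≤ ∑ k ∈ Finset.range K,
      (A + Real.sqrt (24 / ε) * (Metric.diam P.U * ‖P.G‖) * Real.sqrt (2 ^ k * ρ₀)) := by
    rw [totalProjections, Nat.cast_sum]
    refine Finset.sum_le_sum fun k hk => ?_
    rw [innerState_projections]
    have h := (hK.continues (Finset.mem_range.1 hk)).steps_le hP hρ₀ hε
    exact ((Nat.cast_le.2 h).trans (innerBudget_le _ _)).trans (hA k)
  rw [Finset.sum_add_distrib, Finset.sum_const, Finset.card_range, nsmul_eq_mul] at hN
  rw [← mul_assoc (80 * Real.sqrt 3)] at hsum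
  linarith

end AIFALRun
end Problem
end IFAL

theorem mainTheorem4 {n m : ℕ} (P : IFAL.Problem n m) (Lf : ℝ) (hP : P.Assumptions Lf)
    (xs : IFAL.E m) (hxs : P.IsOptimalMultiplier xs) (hxs_norm : 2 ≤ ‖xs‖)
    (ρ₀ ε : ℝ) (hρ₀ : 0 < ρ₀) (hε : 0 < ε) (R : P.AIFALRun Lf ρ₀ ε) :
    ∃ K : ℕ, R.StopsAt K ∧
      (∀ k < K, P.IsInnerSolution (2 ^ k * ρ₀) (ε / 6) (R.callPoint k) (R.innerState k).point) ∧
      P.IsEpsOptimal ε (R.u K) ∧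
      (K : ℝ) ≤ max 1 (Real.logb 2 (16 * ‖xs‖ ^ 2 / (ε * ρ₀))) ∧
      (ρ₀ ≤ 16 * ‖xs‖ ^ 2 / ε →
        (R.totalProjections K : ℝ) ≤
          max 1 (Real.logb 2 (16 * ‖xs‖ ^ 2 / (ε * ρ₀))) *
              max 1 (Real.sqrt (24 * Lf * Metric.diam P.U ^ 2 / ε)) +
            80 * Real.sqrt 3 * Metric.diam P.U * ‖P.G‖ * ‖xs‖ / ε) ∧
      (1 ≤ ρ₀ → ρ₀ ≤ 16 * ‖xs‖ ^ 2 / ε → ε ≤ 8 * ‖xs‖ ^ 2 →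
        ε ≤ 24 * (Lf + ρ₀ * ‖P.G‖ ^ 2) * Metric.diam P.U ^ 2 →
        (R.totalProjections K : ℝ) ≤
          Real.logb 2 (16 * ‖xs‖ ^ 2 / ε) * Real.sqrt (24 * Lf * Metric.diam P.U ^ 2 / ε) +
            80 * Real.sqrt 3 * Metric.diam P.U * ‖P.G‖ * ‖xs‖ / ε) := by
  obtain ⟨K, hK⟩ := IFAL.Problem.AIFALRun.exists_stopsAt hP hρ₀ hε hxs hxs_norm R
  have hKle := hK.le_max_logb hP hρ₀ hε hxs hxs_norm
  have hD : 0 ≤ Metric.diam P.U := Metric.diam_nonneg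
  have hbudget (k : ℕ) := IFAL.two_mul_mul_sqrt_le hP.Lf_pos.le
    (by positivity : 0 ≤ 2 ^ k * ρ₀) hε hD (norm_nonneg P.G)
  refine ⟨K, hK, fun k hk => (hK.continues hk).isInnerSolution hP hρ₀ hε,
    hK.isEpsOptimal hP hρ₀ hε, hKle, fun hle => ?_, fun hρ1 hle hε8 hε24 => ?_⟩
  · refine (hK.totalProjections_le hP hρ₀ hε hxs hxs_norm hle
      (A := max 1 (Real.sqrt (24 * Lf * Metric.diam P.U ^ 2 / ε))) fun k => max_le ?_ ?_).trans ?_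
    · exact (le_max_left 1 _).trans (le_add_of_nonneg_right (by positivity))
    · refine (hbudget k).trans ?_
      rw [mul_assoc (Real.sqrt (24 / ε))]
      gcongr
      exact le_max_right _ _
    · gcongr
  · refine (hK.totalProjections_le hP hρ₀ hε hxs hxs_norm hle
      (A := Real.sqrt (24 * Lf * Metric.diam P.U ^ 2 / ε)) fun k => ?_).trans ?_
    · -- the bound on `ε` makes all inner budgets before rounding at least one
      have h1 : 1 ≤ 2 * Metric.diam P.U *
          Real.sqrt (P.lipLagrangian Lf (2 ^ k * ρ₀) / (ε / 6)) := by
        have h2 : ρ₀ ≤ 2 ^ k * ρ₀ := le_mul_of_one_le_left hρ₀.le (one_le_pow₀ one_le_two)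
        have h3 : 24 * (Lf + ρ₀ * ‖P.G‖ ^ 2) * Metric.diam P.U ^ 2 ≤
            24 * P.lipLagrangian Lf (2 ^ k * ρ₀) * Metric.diam P.U ^ 2 := by
          unfold IFAL.Problem.lipLagrangian
          gcongr
        have hL := IFAL.Problem.lipLagrangian_pos hP (by positivity : 0 ≤ 2 ^ k * ρ₀)
        rw [← pow_le_pow_iff_left₀ zero_le_one (by positivity) two_ne_zero, mul_pow,
          Real.sq_sqrt (by positivity), one_pow, mul_div_assoc', le_div_iff₀ (by positivity)]
        linarith
      rw [max_eq_right h1, ← mul_assoc]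
      exact hbudget k
    · gcongr
      refine hKle.trans (max_le ?_ ?_)
      · rw [Real.le_logb_iff_rpow_le one_lt_two (by positivity), Real.rpow_one,
          le_div_iff₀ hε]
        linarith
      · refine Real.logb_le_logb_of_le one_lt_two (by positivity) ?_
        gcongr
        exact le_mul_of_one_le_right hε.le hρ1
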